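/- Let $n\ge 0$ and let $\Phi_0$ be a real quadratic form on $\mathbf C^n=\mathbf R^{2n}$ that is strictly plurisubharmonic. Then there is $\delta>0$, depending only on $n$ and $\Phi_0$, such that the following holds for every $\Phi\in C^\infty(\mathbf C^n;\mathbf R)$ for which $\Phi-\Phi_0$ is bounded, $\sup_{\mathbf C^n}\left|\frac{\partial\Phi}{\partial x}-\frac{\partial\Phi_0}{\partial x}\right|\le\delta$ (with $\frac{\partial}{\partial x_j}=\frac12(\partial_{\mathrm{Re}\,x_j}-i\,\partial_{\mathrm{Im}\,x_j})$), $\nabla^k\Phi$ is bounded on $\mathbf C^n$ for each $k\ge 2$, and $\Phi$ is uniformly strictly plurisubharmonic, i.e. $\sum_{j,k}\frac{\partial^2\Phi}{\partial x_j\partial\overline{x}_k}(x)\,w_j\overline{w}_k\ge c|w|^2$ for some $c>0$ and all $x,w\in\mathbf C^n$. For $h>0$ let $L^2_\Phi=L^2(\mathbf C^n;e^{-2\Phi/h}L(dx))$, where $L(dx)$ is the Lebesgue measure, let $H_\Phi\subset L^2_\Phi$ be the closed subspace of entire holomorphic functions in $L^2_\Phi$, and let $\Pi_\Phi:L^2_\Phi\to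 H_\Phi$ be the orthogonal projection. For $p\in C_0^\infty(\mathbf C^n)$ (complex valued) let $\mathrm{Top}(p)=\Pi_\Phi\,p\,\Pi_\Phi:H_\Phi\to H_\Phi$ be the Toeplitz operator with symbol $p$. Then, for every $h>0$ and every $p\in C_0^\infty(\mathbf C^n)$, the operator $\mathrm{Top}(p)$ is of trace class. Moreover, there are constants $C>0$ and $h_0>0$, depending only on $n$, $\Phi_0$ and $\Phi$, such that for every $N\in\mathbf N$ there is a continuous seminorm $q_N$ on the Schwartz space $\mathcal S(\mathbf C^n)$ with $$\|\mathrm{Top}(p)\|_{\mathrm{tr}}\le \frac{C}{h^n}\,\|p\|_{L^1}+q_N(p)\,h^N\qquad\text{for all }p\in C_0^\infty(\mathbf C^n)\text{ and all }0<h\le h_0 .$$ -/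

import Mathlib

open MeasureTheory Filter Topology
open scoped ENNReal SchwartzMap ContDiff BoundedContinuousFunction InnerProductSpace

noncomputable section

/-- The Wirtinger derivative `∂f/∂x_j = (∂f/∂(Re x_j) - i ∂f/∂(Im x_j)) / 2`. -/
def wirtinger {n : ℕ} (j : Fin n) (f : (Fin n → ℂ) → ℂ) (x : Fin n → ℂ) : ℂ :=
  (fderiv ℝ f x (Pi.single j 1) - Complex.I * fderiv ℝ f x (Pi.single j Complex.I)) / 2

/-- The Wirtinger derivative `∂f/∂x̄_j = (∂f/∂(Re x_j) + i ∂f/∂(Im x_j)) / 2`. -/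
def wirtingerBar {n : ℕ} (j : Fin n) (f : (Fin n → ℂ) → ℂ) (x : Fin n → ℂ) : ℂ :=
  (fderiv ℝ f x (Pi.single j 1) + Complex.I * fderiv ℝ f x (Pi.single j Complex.I)) / 2

/-- The Levi form `∑ ∂²Φ/∂x_j∂x̄_k (x) w_j w̄_k` of a real function; it is real valued when `Φ` is
of class `C²`. -/
def leviForm {n : ℕ} (Φ : (Fin n → ℂ) → ℝ) (x w : Fin n → ℂ) : ℝ :=
  (∑ j, ∑ k, wirtinger j (wirtingerBar k fun y => (Φ y : ℂ)) x * w j *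
    (starRingEnd ℂ) (w k)).re

/-- Strict plurisubharmonicity of a (smooth) real function: its Levi form is positive definite at
every point. -/
def IsStrictlyPSH {n : ℕ} (Φ : (Fin n → ℂ) → ℝ) : Prop :=
  ∀ x w : Fin n → ℂ, w ≠ 0 → 0 < leviForm Φ x w

/-- Uniform strict plurisubharmonicity of a (smooth) real function: its Levi form is bounded below
by a fixed positive multiple of the Euclidean form. -/
def IsUniformlyStrictlyPSH {n : ℕ} (Φ : (Fin n → ℂ) → ℝ) : Prop :=
  ∃ c : ℝ, 0 < c ∧ ∀ x w : Fin n → ℂ, c * ∑ j, ‖w j‖ ^ 2 ≤ leviForm Φ x w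

/-- The weights `Φ ∈ C^∞(ℂⁿ; ℝ)` that are `δ`-close to the real quadratic form `Φ₀`. -/
structure IsAdmissibleWeight {n : ℕ} (Φ₀ : QuadraticForm ℝ (Fin n → ℂ)) (δ : ℝ)
    (Φ : C(Fin n → ℂ, ℝ)) : Prop where
  /-- `Φ` is smooth. -/
  contDiff : ContDiff ℝ ∞ Φ
  /-- `Φ - Φ₀` is bounded. -/
  bounded_sub : ∃ B : ℝ, ∀ x, |Φ x - Φ₀ x| ≤ B
  /-- `sup |∂Φ/∂x - ∂Φ₀/∂x| ≤ δ`, in the Euclidean norm of `ℂⁿ`. -/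
  gradient_close : ∀ x, √(∑ j, ‖wirtinger j (fun y => (Φ y : ℂ)) x -
    wirtinger j (fun y => (Φ₀ y : ℂ)) x‖ ^ 2) ≤ δ
  /-- `∇^k Φ` is bounded for each `k ≥ 2`. -/
  bounded_deriv : ∀ k : ℕ, 2 ≤ k → ∃ B : ℝ, ∀ x, ‖iteratedFDeriv ℝ k Φ x‖ ≤ B
  /-- `Φ` is uniformly strictly plurisubharmonic. -/
  uniformlyStrictlyPSH : IsUniformlyStrictlyPSH Φ

/-- The trace norm `Tr |T|`, `|T| = (T* T)^{1/2}`, of a bounded operator on a Hilbert space, with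
values in `[0, ∞]`: `∑ ⟨e_i, |T| e_i⟩` over an orthonormal basis. The sum does not depend on the
basis; the supremum below avoids choosing one. -/
def traceNorm {H : Type*} [NormedAddCommGroup H] [InnerProductSpace ℂ H] [CompleteSpace H]
    (T : H →L[ℂ] H) : ℝ≥0∞ :=
  ⨆ (s : Set H) (b : HilbertBasis s ℂ H), ∑' i, ENNReal.ofReal (⟪b i, CFC.abs T (b i)⟫_ℂ).re

/-- A bounded operator on a Hilbert space is of trace class if `Tr |T| < ∞`. -/
def IsTraceClass {H : Type*} [NormedAddCommGroup H] [InnerProductSpace ℂ H] [CompleteSpace H]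
    (T : H →L[ℂ] H) : Prop :=
  traceNorm T < ⊤

/-- The measure `e^{-2Φ/h} L(dx)` on `ℂⁿ`, with `L(dx)` the Lebesgue measure on `ℂⁿ = ℝ²ⁿ`
(here `volume`, the `n`-fold product of the Lebesgue measure of `ℂ = ℝ²`); the weighted space
`L²_Φ` is `Lp ℂ 2 (weightMeasure Φ h)`. -/
def weightMeasure {n : ℕ} (Φ : C(Fin n → ℂ, ℝ)) (h : ℝ) : Measure (Fin n → ℂ) :=
  volume.withDensity fun x => ENNReal.ofReal (Real.exp (-2 * Φ x / h))

/-! The next facts show that the Bergman space is closed in `L²_Φ`, so that the orthogonal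
projection onto it exists. -/

theorem measurePreserving_unit_smul {n : ℕ} (c : ℂ) (hc : ‖c‖ = 1) :
    MeasurePreserving (fun y : Fin n → ℂ => c • y) volume volume := by
  have h1 : MeasurePreserving (fun z : ℂ => c * z) volume volume := by
    have := (rotation (⟨c, by simp [Submonoid.unitSphere, hc]⟩ : Circle)).measurePreserving
    exact this
  exact volume_preserving_pi (fun _ => h1)

theorem enorm_mul_volume_ball_le {n : ℕ} (u : (Fin n → ℂ) → ℂ) (hu : Differentiable ℂ u) (x : Fin n → ℂ) :
    ‖u x‖ₑ * volume (Metric.ball (0 : Fin n → ℂ) 1) ≤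
      ∫⁻ y in Metric.ball (0 : Fin n → ℂ) 1, ‖u (x + y)‖ₑ := by
  have hcont := hu.continuous
  have key : ∀ y, ENNReal.ofReal (2 * Real.pi) * ‖u x‖ₑ ≤
      ∫⁻ θ in Set.Ioc 0 (2 * Real.pi), ‖u (x + circleMap 0 1 θ • y)‖ₑ := by
    intro y
    have hd : Differentiable ℂ (fun z : ℂ => u (x + z • y)) := by fun_prop
    have h1 := DiffContOnCl.circleAverage (f := fun z : ℂ => u (x + z • y)) (c := 0) (R := 1)
      hd.diffContOnCl
    simp only [zero_smul, add_zero, Real.circleAverage] at h1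
    rw [intervalIntegral.integral_of_le Real.two_pi_pos.le] at h1
    rw [← h1, enorm_smul]
    have h2 : ENNReal.ofReal (2 * Real.pi) * ‖(2 * Real.pi)⁻¹‖ₑ = 1 := by
      rw [Real.enorm_eq_ofReal (by positivity), ← ENNReal.ofReal_mul (by positivity),
        mul_inv_cancel₀ (by positivity), ENNReal.ofReal_one]
    rw [← mul_assoc, h2, one_mul]
    exact enorm_integral_le_lintegral_enorm _
  set B := Metric.ball (0 : Fin n → ℂ) 1
  have h3 : ENNReal.ofReal (2 * Real.pi) * (‖u x‖ₑ * volume B) ≤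
      ENNReal.ofReal (2 * Real.pi) * ∫⁻ y in B, ‖u (x + y)‖ₑ := by
    calc ENNReal.ofReal (2 * Real.pi) * (‖u x‖ₑ * volume B)
        = ∫⁻ y in B, ENNReal.ofReal (2 * Real.pi) * ‖u x‖ₑ := by
          rw [setLIntegral_const, mul_assoc]
      _ ≤ ∫⁻ y in B, ∫⁻ θ in Set.Ioc 0 (2 * Real.pi), ‖u (x + circleMap 0 1 θ • y)‖ₑ :=
          lintegral_mono fun y => key y
      _ = ∫⁻ θ in Set.Ioc 0 (2 * Real.pi), ∫⁻ y in B, ‖u (x + circleMap 0 1 θ • y)‖ₑ := by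
          apply lintegral_lintegral_swap
          apply Measurable.aemeasurable
          apply Continuous.measurable
          have : Continuous fun p : (Fin n → ℂ) × ℝ => circleMap 0 1 p.2 :=
            (continuous_circleMap 0 1).comp continuous_snd
          simp only [Function.uncurry_def]
          fun_prop
      _ = ∫⁻ θ in Set.Ioc 0 (2 * Real.pi), ∫⁻ y in B, ‖u (x + y)‖ₑ := by
          refine lintegral_congr fun θ => ?_
          have hn : ‖circleMap 0 1 θ‖ = 1 := by simp [circleMap]
          have hp := (measurePreserving_unit_smul (n := n) _ hn).restrict_preimage (s := B) Metric.isOpen_ball.measurableSet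
          have hB : (fun y : Fin n → ℂ => circleMap 0 1 θ • y) ⁻¹' B = B := by
            ext y; simp [B, norm_smul, hn]
          rw [hB] at hp
          exact hp.lintegral_comp (f := fun y => ‖u (x + y)‖ₑ)
            (by exact (hcont.comp (continuous_const.add continuous_id)).enorm.measurable)
      _ = _ := by
          rw [setLIntegral_const, Real.volume_Ioc, sub_zero, mul_comm]
  exact (ENNReal.mul_le_mul_iff_right (by simp [Real.pi_pos])
    ENNReal.ofReal_ne_top).1 h3

theorem exists_norm_le_mul_eLpNorm {n : ℕ} (Φ : C(Fin n → ℂ, ℝ)) (h R : ℝ) :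
    ∃ C : ℝ, ∀ u : (Fin n → ℂ) → ℂ, Differentiable ℂ u → MemLp u 2 (weightMeasure Φ h) →
      ∀ x ∈ Metric.closedBall (0 : Fin n → ℂ) R,
        ‖u x‖ ≤ C * (eLpNorm u 2 (weightMeasure Φ h)).toReal := by
  set K := Metric.closedBall (0 : Fin n → ℂ) (R + 1)
  obtain ⟨m, hm0, hm⟩ : ∃ m : ℝ, 0 < m ∧ ∀ x ∈ K, m ≤ Real.exp (-2 * Φ x / h) := by
    rcases K.eq_empty_or_nonempty with he | hne
    · exact ⟨1, one_pos, by simp [he]⟩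
    · obtain ⟨x0, _, hx⟩ := (isCompact_closedBall (0 : Fin n → ℂ) (R + 1)).exists_isMinOn hne
        (f := fun x => Real.exp (-2 * Φ x / h)) (by fun_prop)
      exact ⟨_, Real.exp_pos _, fun x hxK => hx hxK⟩
  set M := ENNReal.ofReal m
  have hM0 : M ≠ 0 := by simpa [M] using hm0
  have hMt : M ≠ ⊤ := ENNReal.ofReal_ne_top
  have hle : volume.restrict K ≤ M⁻¹ • weightMeasure Φ h := by
    rw [Measure.le_iff]
    intro s hs
    rw [Measure.restrict_apply hs, Measure.smul_apply, smul_eq_mul, weightMeasure,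
      withDensity_apply _ hs]
    rw [← ENNReal.mul_le_iff_le_inv hM0 hMt]
    calc M * volume (s ∩ K) = ∫⁻ x in s ∩ K, M := by rw [setLIntegral_const]
      _ ≤ ∫⁻ x in s ∩ K, ENNReal.ofReal (Real.exp (-2 * Φ x / h)) := by
          refine setLIntegral_mono' (hs.inter Metric.isClosed_closedBall.measurableSet) ?_
          intro x hx
          exact ENNReal.ofReal_le_ofReal (hm x hx.2)
      _ ≤ _ := lintegral_mono_set Set.inter_subset_left
  set B := Metric.ball (0 : Fin n → ℂ) 1
  have hB0 : volume B ≠ 0 := (Metric.measure_ball_pos volume _ one_pos).ne'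
  have hBt : volume B ≠ ⊤ := measure_ball_lt_top.ne
  set D : ℝ≥0∞ := (volume B)⁻¹ * ((M⁻¹) ^ (1 / 2 : ℝ) * (volume K) ^ (1 / 2 : ℝ))
  have hD : D ≠ ⊤ := by
    refine ENNReal.mul_ne_top (by simpa using hB0) (ENNReal.mul_ne_top ?_ ?_)
    · exact ENNReal.rpow_ne_top_of_nonneg (by norm_num) (by simpa using hM0)
    · exact ENNReal.rpow_ne_top_of_nonneg (by norm_num) measure_closedBall_lt_top.ne
  refine ⟨D.toReal, fun u hu hLp x hx => ?_⟩
  have h1 := enorm_mul_volume_ball_le u hu x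
  have h2 : ∫⁻ y in B, ‖u (x + y)‖ₑ ≤ ∫⁻ y in K, ‖u y‖ₑ := by
    have hp : MeasurePreserving (fun y : Fin n → ℂ => x + y) volume volume :=
      measurePreserving_add_left volume x
    have hp' := hp.restrict_preimage (s := Metric.ball x 1) Metric.isOpen_ball.measurableSet
    have hB : (fun y : Fin n → ℂ => x + y) ⁻¹' Metric.ball x 1 = B := by
      ext y; simp [B]
    rw [hB] at hp'
    rw [hp'.lintegral_comp (f := fun y => ‖u y‖ₑ) (hu.continuous.enorm.measurable)]
    refine lintegral_mono_set fun y hy => ?_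
    simp only [Metric.mem_ball, Metric.mem_closedBall, K, dist_zero_right] at *
    have := norm_sub_norm_le y x
    rw [dist_eq_norm] at hy
    linarith
  have h3 : ∫⁻ y in K, ‖u y‖ₑ ≤ (M⁻¹) ^ (1 / 2 : ℝ) * (volume K) ^ (1 / 2 : ℝ) *
      eLpNorm u 2 (weightMeasure Φ h) := by
    rw [← eLpNorm_one_eq_lintegral_enorm]
    refine (eLpNorm_le_eLpNorm_mul_rpow_measure_univ (q := 2) (by norm_num)
      hu.continuous.aestronglyMeasurable).trans ?_
    have h4 : eLpNorm u 2 (volume.restrict K) ≤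
        (M⁻¹) ^ (1 / 2 : ℝ) * eLpNorm u 2 (weightMeasure Φ h) := by
      refine (eLpNorm_mono_measure u hle).trans ?_
      rw [eLpNorm_smul_measure_of_ne_top (by norm_num)]
      simp
    have h5 : (1 / (1 : ℝ≥0∞).toReal - 1 / (2 : ℝ≥0∞).toReal) = (1 / 2 : ℝ) := by norm_num
    rw [Measure.restrict_apply_univ, h5]
    calc _ ≤ (M⁻¹) ^ (1 / 2 : ℝ) * eLpNorm u 2 (weightMeasure Φ h) * volume K ^ (1 / 2 : ℝ) := by
          gcongr
      _ = _ := by ring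
  have h6 : ‖u x‖ₑ ≤ D * eLpNorm u 2 (weightMeasure Φ h) := by
    have h7 := (h1.trans h2).trans h3
    rw [mul_comm, ENNReal.mul_le_iff_le_inv hB0 hBt] at h7
    refine h7.trans (le_of_eq ?_)
    simp only [D]; ring
  have := ENNReal.toReal_mono (ENNReal.mul_ne_top hD hLp.2.ne) h6
  simpa [ENNReal.toReal_mul] using this

/-- The weighted Bergman space `H_Φ = Hol(ℂⁿ) ∩ L²_Φ`: the classes in `L²_Φ` of entire functions. -/
def bergmanSpace {n : ℕ} (Φ : C(Fin n → ℂ, ℝ)) (h : ℝ) :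
    Submodule ℂ (Lp ℂ 2 (weightMeasure Φ h)) where
  carrier := {f | ∃ u : (Fin n → ℂ) → ℂ, Differentiable ℂ u ∧ f =ᵐ[weightMeasure Φ h] u}
  zero_mem' := ⟨fun _ => 0, by fun_prop, Lp.coeFn_zero _ _ _⟩
  add_mem' := by
    rintro f g ⟨u, hu, hfu⟩ ⟨v, hv, hgv⟩
    exact ⟨u + v, hu.add hv, (Lp.coeFn_add f g).trans (hfu.add hgv)⟩
  smul_mem' := by
    rintro c f ⟨u, hu, hfu⟩
    exact ⟨c • u, hu.const_smul c, (Lp.coeFn_smul c f).trans (hfu.const_smul c)⟩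

theorem norm_fderiv_le_of_bound {n : ℕ} (u : (Fin n → ℂ) → ℂ) (hu : Differentiable ℂ u)
    (x : Fin n → ℂ) (C : ℝ) (hC : ∀ y, ‖y‖ ≤ ‖x‖ + 1 → ‖u y‖ ≤ C) : ‖fderiv ℂ u x‖ ≤ C := by
  have hC0 : 0 ≤ C := (norm_nonneg _).trans (hC x (by simp))
  refine ContinuousLinearMap.opNorm_le_of_unit_norm hC0 fun v hv => ?_
  have hd : Differentiable ℂ (fun z : ℂ => u (x + z • v)) := by fun_prop
  have h1 := Complex.norm_deriv_le_of_forall_mem_sphere_norm_le (c := 0) (C := C) one_pos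
    hd.diffContOnCl (fun z hz => hC _ ?_)
  · have h2 : HasDerivAt (fun z : ℂ => x + z • v) v 0 := by
      simpa using ((hasDerivAt_id (0 : ℂ)).smul_const v).const_add x
    have h3 : HasFDerivAt u (fderiv ℂ u x) (x + (0 : ℂ) • v) := by
      simpa using (hu x).hasFDerivAt
    have h4 := (h3.comp_hasDerivAt (0 : ℂ) h2).deriv
    simp only [Function.comp_def] at h4
    rw [h4, div_one] at h1
    exact h1
  · refine (norm_add_le _ _).trans ?_
    simp only [mem_sphere_iff_norm, sub_zero] at hz
    rw [norm_smul, hz, hv, one_mul]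

theorem isClosed_bergmanSpace {n : ℕ} (Φ : C(Fin n → ℂ, ℝ)) (h : ℝ) :
    IsClosed (bergmanSpace Φ h : Set (Lp ℂ 2 (weightMeasure Φ h))) := by
  refine IsSeqClosed.isClosed fun F f hF hlim => ?_
  choose u hu hFu using hF
  have hdiff : ∀ R : ℝ, ∃ C : ℝ, 0 ≤ C ∧ ∀ k l, ∀ x ∈ Metric.closedBall (0 : Fin n → ℂ) R,
      ‖u k x - u l x‖ ≤ C * dist (F k) (F l) := by
    intro R
    obtain ⟨C, hC⟩ := exists_norm_le_mul_eLpNorm Φ h R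
    refine ⟨max C 0, le_max_right _ _, fun k l x hx => ?_⟩
    have hae : (F k - F l : Lp ℂ 2 (weightMeasure Φ h)) =ᵐ[weightMeasure Φ h] u k - u l :=
      (Lp.coeFn_sub _ _).trans ((hFu k).sub (hFu l))
    have h1 := hC (u k - u l) ((hu k).sub (hu l)) ((Lp.memLp (F k - F l)).ae_eq hae) x hx
    rw [← eLpNorm_congr_ae hae, ← Lp.norm_def, ← dist_eq_norm] at h1
    exact h1.trans (mul_le_mul_of_nonneg_right (le_max_left _ _) dist_nonneg)
  have hcau : ∀ C : ℝ, 0 ≤ C → ∀ ε > 0, ∃ N, ∀ k ≥ N, ∀ l ≥ N, C * dist (F k) (F l) < ε := by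
    intro C hC ε hε
    obtain ⟨N, hN⟩ := Metric.cauchySeq_iff.1 hlim.cauchySeq (ε / (C + 1)) (by positivity)
    refine ⟨N, fun k hk l hl => ?_⟩
    have h1 := hN k hk l hl
    rw [lt_div_iff₀ (by positivity)] at h1
    nlinarith [dist_nonneg (x := F k) (y := F l)]
  have hpt : ∀ x, ∃ U, Tendsto (fun k => u k x) atTop (𝓝 U) := by
    intro x
    obtain ⟨C, hC0, hC⟩ := hdiff ‖x‖
    refine cauchySeq_tendsto_of_complete (Metric.cauchySeq_iff.2 fun ε hε => ?_)
    obtain ⟨N, hN⟩ := hcau C hC0 ε hε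
    refine ⟨N, fun k hk l hl => ?_⟩
    rw [dist_eq_norm]
    exact (hC k l x (by simp)).trans_lt (hN k hk l hl)
  choose U hU using hpt
  have hder : ∀ R : ℝ, ∃ C : ℝ, 0 ≤ C ∧ ∀ k l, ∀ x ∈ Metric.closedBall (0 : Fin n → ℂ) R,
      ‖fderiv ℂ (u k) x - fderiv ℂ (u l) x‖ ≤ C * dist (F k) (F l) := by
    intro R
    obtain ⟨C, hC0, hC⟩ := hdiff (R + 1)
    refine ⟨C, hC0, fun k l x hx => ?_⟩
    rw [← fderiv_sub (hu k x) (hu l x)]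
    refine norm_fderiv_le_of_bound _ ((hu k).sub (hu l)) x _ fun y hy => hC k l y ?_
    simp only [Metric.mem_closedBall, dist_zero_right] at *
    linarith
  have hpt' : ∀ x, ∃ G, Tendsto (fun k => fderiv ℂ (u k) x) atTop (𝓝 G) := by
    intro x
    obtain ⟨C, hC0, hC⟩ := hder ‖x‖
    refine cauchySeq_tendsto_of_complete (Metric.cauchySeq_iff.2 fun ε hε => ?_)
    obtain ⟨N, hN⟩ := hcau C hC0 ε hε
    refine ⟨N, fun k hk l hl => ?_⟩
    rw [dist_eq_norm]
    exact (hC k l x (by simp)).trans_lt (hN k hk l hl)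
  choose G hG using hpt'
  have hUdiff : Differentiable ℂ U := by
    intro x
    have hunif : TendstoUniformlyOn (fun k x => fderiv ℂ (u k) x) G atTop
        (Metric.ball 0 (‖x‖ + 1)) := by
      refine UniformCauchySeqOn.tendstoUniformlyOn_of_tendsto ?_ fun y _ => hG y
      rw [Metric.uniformCauchySeqOn_iff]
      intro ε hε
      obtain ⟨C, hC0, hC⟩ := hder (‖x‖ + 1)
      obtain ⟨N, hN⟩ := hcau C hC0 ε hε
      refine ⟨N, fun k hk l hl y hy => ?_⟩
      rw [dist_eq_norm]
      exact (hC k l y (Metric.ball_subset_closedBall hy)).trans_lt (hN k hk l hl)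
    exact (hasFDerivAt_of_tendstoUniformlyOn Metric.isOpen_ball hunif
      (fun k y _ => (hu k y).hasFDerivAt) (fun y _ => hU y) (by simp)).differentiableAt
  refine ⟨U, hUdiff, ?_⟩
  obtain ⟨ns, hns, hae⟩ := (tendstoInMeasure_of_tendsto_Lp hlim).exists_seq_tendsto_ae
  filter_upwards [hae, ae_all_iff.2 hFu] with x hx hx2
  refine tendsto_nhds_unique hx ?_
  simp only [hx2]
  exact (hU x).comp hns.tendsto_atTop

instance {n : ℕ} (Φ : C(Fin n → ℂ, ℝ)) (h : ℝ) : CompleteSpace (bergmanSpace Φ h) :=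
  (isClosed_bergmanSpace Φ h).completeSpace_coe

/-- The orthogonal projection `Π_Φ : L²_Φ → H_Φ`. -/
def bergmanProj {n : ℕ} (Φ : C(Fin n → ℂ, ℝ)) (h : ℝ) :
    Lp ℂ 2 (weightMeasure Φ h) →L[ℂ] bergmanSpace Φ h :=
  (bergmanSpace Φ h).orthogonalProjectionOnto

/-- Multiplication by a bounded continuous function `p`, as a bounded operator on `L²_Φ`. -/
def mulOp {n : ℕ} (Φ : C(Fin n → ℂ, ℝ)) (h : ℝ) (p : (Fin n → ℂ) →ᵇ ℂ) :
    Lp ℂ 2 (weightMeasure Φ h) →L[ℂ] Lp ℂ 2 (weightMeasure Φ h) :=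
  (ContinuousLinearMap.mul ℂ ℂ).holderL (weightMeasure Φ h) ∞ 2 2
    ((memLp_top_of_bound p.continuous.aestronglyMeasurable ‖p‖
      (Eventually.of_forall p.norm_coe_le_norm)).toLp p)

/-- The Toeplitz operator `Top(p) = Π_Φ p Π_Φ : H_Φ → H_Φ`. -/
def toeplitz {n : ℕ} (Φ : C(Fin n → ℂ, ℝ)) (h : ℝ) (p : (Fin n → ℂ) →ᵇ ℂ) :
    bergmanSpace Φ h →L[ℂ] bergmanSpace Φ h :=
  bergmanProj Φ h ∘L mulOp Φ h p ∘L (bergmanSpace Φ h).subtypeL ∘L bergmanProj Φ h ∘L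
    (bergmanSpace Φ h).subtypeL

end

/-!
Write `k_x ∈ H_Φ` for the element representing evaluation at `x`. Then `Top(p)` is the superposition
`∫ p(x) k_x ⊗ k_x^* e^{-2Φ(x)/h} L(dx)` of operators of rank one, so its trace norm is at most
`∫ |p(x)| ‖k_x‖² e^{-2Φ(x)/h} L(dx)`, and it remains to see that the Bergman kernel on the diagonal
satisfies `‖k_x‖² e^{-2Φ(x)/h} ≤ C h⁻ⁿ`. Since the second derivatives of `Φ` are bounded, `Φ` differs
by `O(h)` from the real part of a complex affine function on the ball of radius `√h` around `x`; hence
`|u|² e^{-2Φ/h}` is there comparable to the modulus of a holomorphic function, and the mean value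
property gives the bound (`exists_forall_norm_sq_le`). This yields `‖Top(p)‖_tr ≤ C h⁻ⁿ ‖p‖_{L¹}` for
every `h > 0`, with no error term.

The integral of rank one operators is not formed. Instead, `traceNorm_le_of_forall_contraction`
reduces the trace norm of `T` to finite sums `∑ Re ⟨V b_i, T b_i⟩` over orthonormal vectors `b_i`, for
contractions `V`; here `V` approximates the partial isometry of the polar decomposition of `T`. For
`T = Top(p)` such a sum is an integral of `p(x) ∑ f_i(x) g_i(x)^*`, where `f_i` and `g_i` are the
holomorphic representatives of `b_i` and `V b_i`, and Bessel's inequality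
(`sum_norm_sq_le_of_orthonormal`) bounds `∑ |f_i(x)|²` and `∑ |g_i(x)|²` by the bound on `‖k_x‖²`.
-/

/-! ### The trace norm and contractions -/

section TraceNorm

variable {H : Type*} [NormedAddCommGroup H] [InnerProductSpace ℂ H] [CompleteSpace H]

theorem norm_cfcAbs_apply (T : H →L[ℂ] H) (x : H) : ‖CFC.abs T x‖ = ‖T x‖ := by
  have hsa : IsSelfAdjoint (CFC.abs T) := (CFC.abs_nonneg T).isSelfAdjoint
  have h1 : ⟪CFC.abs T x, CFC.abs T x⟫_ℂ = ⟪T x, T x⟫_ℂ := by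
    rw [← ContinuousLinearMap.adjoint_inner_right, ← ContinuousLinearMap.adjoint_inner_right,
      ← ContinuousLinearMap.star_eq_adjoint, ← ContinuousLinearMap.star_eq_adjoint, hsa.star_eq,
      ← mul_apply_eq_comp, ← mul_apply_eq_comp, CFC.abs_mul_abs]
  rw [← sq_eq_sq₀ (norm_nonneg _) (norm_nonneg _)]
  rw [inner_self_eq_norm_sq_to_K, inner_self_eq_norm_sq_to_K] at h1
  exact_mod_cast h1

/-- An approximate polar decomposition: `V = T (|T| + ε)⁻¹` is a contraction, and `V* T` differs from
`|T|` by `ε |T| (|T| + ε)⁻¹`, whose norm is at most `ε`. -/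
theorem exists_contraction_adjoint_comp_near_abs (T : H →L[ℂ] H) {ε : ℝ} (hε : 0 < ε) :
    ∃ V : H →L[ℂ] H, ‖V‖ ≤ 1 ∧ ‖CFC.abs T - star V * T‖ ≤ ε := by
  set A := CFC.abs T with hA
  have hA0 : 0 ≤ A := CFC.abs_nonneg T
  have hAsa : star A = A := hA0.isSelfAdjoint.star_eq
  set S : H →L[ℂ] H := algebraMap ℝ _ ε + A with hS
  have hSsa : star S = S := by
    have h1 : star (algebraMap ℝ (H →L[ℂ] H) ε) = algebraMap ℝ (H →L[ℂ] H) ε := by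
      rw [Algebra.algebraMap_eq_smul_one, star_smul, star_one, star_trivial]
    rw [hS, star_add, hAsa, h1]
  have hSapp : ∀ y, S y = A y + ε • y := by
    intro y
    rw [hS, Algebra.algebraMap_eq_smul_one, add_comm]
    rfl
  have hunit : IsUnit S := by
    by_contra hne
    have hmem : -ε ∈ spectrum ℝ A := by
      rw [spectrum.mem_iff, map_neg]
      intro hu
      apply hne
      simpa [hS, sub_eq_add_neg, add_comm] using hu.neg
    have := spectrum_nonneg_of_nonneg hA0 hmem
    linarith
  obtain ⟨u, hu⟩ := hunit
  set R : H →L[ℂ] H := ((u⁻¹ : (H →L[ℂ] H)ˣ) : H →L[ℂ] H) with hR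
  have hSR : S * R = 1 := by rw [← hu]; exact u.mul_inv
  have hRS : R * S = 1 := by rw [← hu]; exact u.inv_mul
  have hRsa : star R = R := by
    have h1 : star R * S = 1 := by
      nth_rewrite 1 [← hSsa]
      rw [← star_mul, hSR, star_one]
    calc star R = star R * (S * R) := by rw [hSR, mul_one]
      _ = R := by rw [← mul_assoc, h1, one_mul]
  have hle : ∀ y, ‖A y‖ ≤ ‖S y‖ := by
    intro y
    have hpos : 0 ≤ (⟪A y, y⟫_ℂ).re :=
      ((ContinuousLinearMap.nonneg_iff_isPositive A).1 hA0).re_inner_nonneg_left y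
    rw [hSapp, ← sq_le_sq₀ (norm_nonneg _) (norm_nonneg _), @norm_add_sq ℂ]
    have h2 : RCLike.re ⟪A y, ε • y⟫_ℂ = ε * (⟪A y, y⟫_ℂ).re := by
      rw [← Complex.coe_smul, inner_smul_right]
      simp
    rw [h2]
    nlinarith [mul_nonneg hε.le hpos, sq_nonneg ‖ε • y‖]
  have happ : ∀ x, S (R x) = x := fun x => by
    rw [← mul_apply_eq_comp, hSR]; rfl
  have hAR : ‖A * R‖ ≤ 1 := by
    refine ContinuousLinearMap.opNorm_le_bound _ zero_le_one fun x => ?_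
    simpa [happ] using hle (R x)
  refine ⟨T * R, ?_, ?_⟩
  · refine ContinuousLinearMap.opNorm_le_bound _ zero_le_one fun x => ?_
    rw [mul_apply_eq_comp, ← norm_cfcAbs_apply]
    simpa [happ] using hle (R x)
  · have h1 : A - star (T * R) * T = ε • star (A * R) := by
      have h3 : star (T * R) * T = R * (A * A) := by
        rw [star_mul, hRsa, mul_assoc, hA, CFC.abs_mul_abs]
      have h4 : A = R * (ε • A) + R * (A * A) := by
        rw [← mul_add]
        have : ε • A + A * A = S * A := by
          rw [hS, add_mul, Algebra.algebraMap_eq_smul_one, smul_mul_assoc, one_mul]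
        rw [this, ← mul_assoc, hRS, one_mul]
      rw [h3, star_mul, hRsa, hAsa]
      nth_rewrite 1 [h4]
      rw [add_sub_cancel_right, mul_smul_comm]
    rw [h1, norm_smul, norm_star, Real.norm_of_nonneg hε.le]
    nlinarith

/-- A bound on the trace norm by duality with contractions: the sums `∑ Re ⟨V b_i, T b_i⟩` are finite
pieces of `Re Tr (V* T)`, and `V` may be taken close to the partial isometry of the polar
decomposition of `T`. -/
theorem traceNorm_le_of_forall_contraction (T : H →L[ℂ] H) (K : ℝ)
    (hK : ∀ (s : Set H) (b : HilbertBasis s ℂ H) (t : Finset s) (V : H →L[ℂ] H), ‖V‖ ≤ 1 →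
      ∑ i ∈ t, (⟪V (b i), T (b i)⟫_ℂ).re ≤ K) :
    traceNorm T ≤ ENNReal.ofReal K := by
  refine iSup₂_le fun s b => ?_
  rw [ENNReal.tsum_eq_iSup_sum]
  refine iSup_le fun t => ?_
  have hpos : ∀ x, 0 ≤ (⟪x, CFC.abs T x⟫_ℂ).re :=
    ((ContinuousLinearMap.nonneg_iff_isPositive _).1 (CFC.abs_nonneg T)).re_inner_nonneg_right
  rw [← ENNReal.ofReal_sum_of_nonneg fun i _ => hpos (b i)]
  refine ENNReal.ofReal_le_ofReal (le_of_forall_pos_le_add fun ε hε => ?_)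
  obtain ⟨V, hV, hVT⟩ := exists_contraction_adjoint_comp_near_abs T
    (ε := ε / (t.card + 1)) (by positivity)
  have hterm : ∀ i ∈ t, (⟪b i, CFC.abs T (b i)⟫_ℂ).re ≤
      (⟪V (b i), T (b i)⟫_ℂ).re + ε / (t.card + 1) := by
    intro i _
    have h1 : ⟪V (b i), T (b i)⟫_ℂ = ⟪b i, (star V * T) (b i)⟫_ℂ := by
      rw [mul_apply_eq_comp, ContinuousLinearMap.star_eq_adjoint,
        ContinuousLinearMap.adjoint_inner_right]
    have h2 : ‖⟪b i, (CFC.abs T - star V * T) (b i)⟫_ℂ‖ ≤ ε / (t.card + 1) := by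
      refine (norm_inner_le_norm _ _).trans ?_
      have := (CFC.abs T - star V * T).le_of_opNorm_le hVT (b i)
      simpa [b.orthonormal.1 i] using this
    have h3 := (Complex.re_le_norm _).trans h2
    rw [sub_apply, inner_sub_right, Complex.sub_re, ← h1] at h3
    linarith
  refine (Finset.sum_le_sum hterm).trans ?_
  rw [Finset.sum_add_distrib, Finset.sum_const, nsmul_eq_mul]
  refine add_le_add (hK s b t V hV) ?_
  rw [mul_div_assoc', div_le_iff₀ (by positivity)]
  nlinarith

end TraceNorm

/-! ### The weighted mean value property -/

theorem abs_sub_sub_fderiv_le {E : Type*} [NormedAddCommGroup E] [NormedSpace ℝ E] {f : E → ℝ}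
    (hf : ContDiff ℝ 2 f) {B : ℝ} (hB : ∀ x, ‖iteratedFDeriv ℝ 2 f x‖ ≤ B) (x z : E) :
    |f (x + z) - f x - fderiv ℝ f x z| ≤ B * ‖z‖ ^ 2 := by
  have hd : Differentiable ℝ f := hf.differentiable (by norm_num)
  have hd' : Differentiable ℝ (fderiv ℝ f) :=
    (hf.fderiv_right (m := 1) (by norm_num)).differentiable (by norm_num)
  have hB' : ∀ y, ‖fderiv ℝ (fderiv ℝ f) y‖ ≤ B := fun y => by
    rw [← norm_iteratedFDeriv_one, norm_iteratedFDeriv_fderiv]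
    exact hB y
  have hB0 : 0 ≤ B := (norm_nonneg (fderiv ℝ (fderiv ℝ f) x)).trans (hB' x)
  have hlip : ∀ y ∈ Metric.closedBall x ‖z‖, ‖fderiv ℝ f y - fderiv ℝ f x‖ ≤ B * ‖z‖ := by
    intro y hy
    have := convex_univ.norm_image_sub_le_of_norm_fderiv_le (𝕜 := ℝ) (f := fderiv ℝ f) (C := B)
      (fun w _ => hd' w) (fun w _ => hB' w) (Set.mem_univ x) (Set.mem_univ y)
    refine this.trans (mul_le_mul_of_nonneg_left ?_ hB0)
    simpa [dist_eq_norm] using hy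
  have := (convex_closedBall x ‖z‖).norm_image_sub_le_of_norm_fderiv_le' (𝕜 := ℝ) (f := f)
    (fun w _ => hd w) hlip (x := x) (y := x + z) (by simp) (by simp)
  simpa [sq, mul_assoc] using this

theorem lintegral_comp_add_smul {n : ℕ} (g : (Fin n → ℂ) → ℝ≥0∞) (x : Fin n → ℂ)
    {r : ℝ} (hr : 0 < r) :
    ∫⁻ y, g (x + r • y) = ENNReal.ofReal ((r ^ (2 * n))⁻¹) * ∫⁻ y, g y := by
  have hm : MeasurableEmbedding (fun y : Fin n → ℂ => r • y) :=
    (Homeomorph.smulOfNeZero r hr.ne').measurableEmbedding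
  have hfr : Module.finrank ℝ (Fin n → ℂ) = 2 * n := by
    rw [Module.finrank_pi_fintype]; simp [mul_comm]
  rw [← hm.lintegral_map (fun y => g (x + y)), Measure.map_addHaar_smul volume hr.ne',
    lintegral_smul_measure, lintegral_add_left_eq_self g x, hfr, abs_of_pos (by positivity),
    smul_eq_mul]

/-- The weighted sub-mean value property at scale `√h`. As `Φ` differs from the real part of a
complex affine function by `O(h)` on the ball of radius `√h` around `x`, the weight can be absorbed
there, up to a constant factor, in the modulus of a holomorphic function. -/
theorem enorm_sq_mul_exp_le {n : ℕ} (Φ : C(Fin n → ℂ, ℝ)) (hΦ : ContDiff ℝ 2 Φ) {B : ℝ}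
    (hB : ∀ x, ‖iteratedFDeriv ℝ 2 Φ x‖ ≤ B) {h : ℝ} (hh : 0 < h) (u : (Fin n → ℂ) → ℂ)
    (hu : Differentiable ℂ u) (x : Fin n → ℂ) :
    ‖u x‖ₑ ^ 2 * ENNReal.ofReal (Real.exp (-2 * Φ x / h)) *
        volume (Metric.ball (0 : Fin n → ℂ) 1) ≤
      ENNReal.ofReal (Real.exp (2 * B) / h ^ n) * ∫⁻ y, ‖u y‖ₑ ^ 2 ∂(weightMeasure Φ h) := by
  set L := fderiv ℝ Φ x with hL
  set ℓ : StrongDual ℂ (Fin n → ℂ) := StrongDual.extendRCLike L with hℓ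
  have hre : ∀ z, (ℓ z).re = L z := fun z => StrongDual.re_extendRCLike_apply (𝕜 := ℂ) L z
  -- `v` is the square of `u(x + √h y) exp(-(Φ(x) + 2 ∂Φ(x)·√h y) / h)`, an entire function of `y`.
  set v : (Fin n → ℂ) → ℂ := fun y =>
    (u (x + (√h : ℂ) • y)) ^ 2 * Complex.exp (((-2 / h : ℝ) : ℂ) * (Φ x + ℓ ((√h : ℂ) • y)))
    with hv
  have hvd : Differentiable ℂ v := by
    rw [hv]
    fun_prop
  have hnv : ∀ y, ‖v y‖ₑ = ‖u (x + (√h : ℂ) • y)‖ₑ ^ 2 *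
      ENNReal.ofReal (Real.exp (-2 / h * (Φ x + L (√h • y)))) := by
    intro y
    rw [hv]
    simp only
    rw [enorm_mul, enorm_pow]
    congr 1
    rw [← ofReal_norm, Complex.norm_exp, Complex.re_ofReal_mul, Complex.add_re,
      Complex.ofReal_re, hre]
    rfl
  have hv0 : ‖u x‖ₑ ^ 2 * ENNReal.ofReal (Real.exp (-2 * Φ x / h)) = ‖v 0‖ₑ := by
    rw [hnv]
    simp only [smul_zero, add_zero, map_zero, mul_div_right_comm]
  rw [hv0]
  refine (enorm_mul_volume_ball_le v hvd 0).trans ?_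
  set g : (Fin n → ℂ) → ℝ≥0∞ := fun y => ENNReal.ofReal (Real.exp (-2 * Φ y / h)) * ‖u y‖ₑ ^ 2
    with hg
  have hμ : ∫⁻ y, ‖u y‖ₑ ^ 2 ∂(weightMeasure Φ h) = ∫⁻ y, g y := by
    rw [weightMeasure, lintegral_withDensity_eq_lintegral_mul₀]
    · rfl
    · exact (ENNReal.continuous_ofReal.comp (by fun_prop)).measurable.aemeasurable
    · exact (hu.continuous.enorm.measurable.pow_const 2).aemeasurable
  calc ∫⁻ y in Metric.ball (0 : Fin n → ℂ) 1, ‖v (0 + y)‖ₑ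
      ≤ ∫⁻ y in Metric.ball (0 : Fin n → ℂ) 1,
          ENNReal.ofReal (Real.exp (2 * B)) * g (x + √h • y) := by
        refine setLIntegral_mono' Metric.isOpen_ball.measurableSet fun y hy => ?_
        rw [zero_add, hnv, hg]
        simp only
        rw [← mul_assoc, ← ENNReal.ofReal_mul (Real.exp_pos _).le, ← Real.exp_add, mul_comm]
        have hsm : (√h : ℂ) • y = √h • y := rfl
        rw [hsm]
        gcongr
        have h1 := (abs_le.1 (abs_sub_sub_fderiv_le hΦ hB x (√h • y))).2
        have hy1 : ‖y‖ ≤ 1 := by simpa using (Metric.mem_ball.1 hy).le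
        have hB0 : 0 ≤ B := (norm_nonneg _).trans (hB x)
        have h2 : ‖√h • y‖ ^ 2 ≤ h := by
          rw [norm_smul, mul_pow, Real.norm_of_nonneg (Real.sqrt_nonneg _), Real.sq_sqrt hh.le]
          have : ‖y‖ ^ 2 ≤ 1 := pow_le_one₀ (norm_nonneg _) hy1
          nlinarith
        have h3 : Φ (x + √h • y) ≤ Φ x + L (√h • y) + B * h := by
          nlinarith [mul_le_mul_of_nonneg_left h2 hB0]
        have h4 : 2 * B + -2 * Φ (x + √h • y) / h - -2 / h * (Φ x + L (√h • y)) =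
            2 / h * (Φ x + L (√h • y) + B * h - Φ (x + √h • y)) := by
          field_simp
          ring
        have h5 : 0 ≤ 2 / h * (Φ x + L (√h • y) + B * h - Φ (x + √h • y)) :=
          mul_nonneg (by positivity) (by linarith)
        linarith
    _ ≤ ∫⁻ y, ENNReal.ofReal (Real.exp (2 * B)) * g (x + √h • y) := setLIntegral_le_lintegral _ _
    _ = _ := by
        rw [lintegral_const_mul' _ _ ENNReal.ofReal_ne_top,
          lintegral_comp_add_smul g x (Real.sqrt_pos.2 hh), hμ, ← mul_assoc,
          ← ENNReal.ofReal_mul (Real.exp_pos _).le, pow_mul, Real.sq_sqrt hh.le, div_eq_mul_inv]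

/-- Holomorphic functions in `L²_Φ` satisfy `|u(x)|² ≤ C h⁻ⁿ e^{2Φ(x)/h} ‖u‖²`, with `C` independent
of `h`: this bounds the Bergman kernel on the diagonal. -/
theorem exists_forall_norm_sq_le {n : ℕ} (Φ : C(Fin n → ℂ, ℝ)) (hΦ : ContDiff ℝ 2 Φ)
    (hB : ∃ B : ℝ, ∀ x, ‖iteratedFDeriv ℝ 2 Φ x‖ ≤ B) :
    ∃ C : ℝ, 0 < C ∧ ∀ h : ℝ, 0 < h → ∀ (f : Lp ℂ 2 (weightMeasure Φ h)) (u : (Fin n → ℂ) → ℂ),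
      Differentiable ℂ u → f =ᵐ[weightMeasure Φ h] u → ∀ x,
        ‖u x‖ ^ 2 ≤ C / h ^ n * Real.exp (2 * Φ x / h) * ‖f‖ ^ 2 := by
  obtain ⟨B, hB⟩ := hB
  set β := volume (Metric.ball (0 : Fin n → ℂ) 1) with hβ
  have hβ0 : β ≠ 0 := (Metric.measure_ball_pos volume _ one_pos).ne'
  have hβt : β ≠ ⊤ := measure_ball_lt_top.ne
  have hβr : 0 < β.toReal := ENNReal.toReal_pos hβ0 hβt
  refine ⟨Real.exp (2 * B) / β.toReal, by positivity, fun h hh f u hu hfu x => ?_⟩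
  have h1 := enorm_sq_mul_exp_le Φ hΦ hB hh u hu x
  have h2 : ∫⁻ y, ‖u y‖ₑ ^ 2 ∂(weightMeasure Φ h) = ENNReal.ofReal (‖f‖ ^ 2) := by
    have h3 : ∫⁻ y, ‖u y‖ₑ ^ 2 ∂(weightMeasure Φ h) = ∫⁻ y, ‖f y‖ₑ ^ 2 ∂(weightMeasure Φ h) :=
      lintegral_congr_ae (hfu.mono fun y hy => by simp only [hy])
    have h4 := eLpNorm_nnreal_pow_eq_lintegral (f := f) (μ := weightMeasure Φ h) (p := 2)
      (by norm_num)
    rw [h3, ENNReal.ofReal_pow (norm_nonneg _), Lp.norm_def,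
      ENNReal.ofReal_toReal (Lp.eLpNorm_ne_top f)]
    simpa using h4.symm
  rw [h2, ← ENNReal.ofReal_mul (by positivity)] at h1
  have h5 := ENNReal.toReal_mono ENNReal.ofReal_ne_top h1
  rw [ENNReal.toReal_mul, ENNReal.toReal_mul, ENNReal.toReal_pow, toReal_enorm,
    ENNReal.toReal_ofReal (Real.exp_pos _).le, ENNReal.toReal_ofReal (by positivity)] at h5
  have h6 : Real.exp (-2 * Φ x / h) * Real.exp (2 * Φ x / h) = 1 := by
    rw [← Real.exp_add]; convert Real.exp_zero using 2; ring
  calc ‖u x‖ ^ 2 = ‖u x‖ ^ 2 * Real.exp (-2 * Φ x / h) * β.toReal *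
        (Real.exp (2 * Φ x / h) / β.toReal) := by
        rw [mul_assoc (_ * _), mul_div_cancel₀ _ hβr.ne', mul_assoc, h6, mul_one]
    _ ≤ Real.exp (2 * B) / h ^ n * ‖f‖ ^ 2 * (Real.exp (2 * Φ x / h) / β.toReal) := by gcongr
    _ = _ := by ring

/-! ### Toeplitz operators on the Bergman space -/

/-- The values at a point of the images under a contraction of an orthonormal family satisfy a Bessel
inequality, whose constant bounds evaluation at that point. -/
theorem sum_norm_sq_le_of_orthonormal {n : ℕ} {Φ : C(Fin n → ℂ, ℝ)} {h : ℝ} {x : Fin n → ℂ} {M : ℝ}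
    (hM0 : 0 ≤ M) (hM : ∀ (f : Lp ℂ 2 (weightMeasure Φ h)) (u : (Fin n → ℂ) → ℂ),
      Differentiable ℂ u → f =ᵐ[weightMeasure Φ h] u → ‖u x‖ ^ 2 ≤ M * ‖f‖ ^ 2)
    {ι : Type*} {b : ι → bergmanSpace Φ h} (hb : Orthonormal ℂ b)
    {V : bergmanSpace Φ h →L[ℂ] bergmanSpace Φ h} (hV : ‖V‖ ≤ 1) {g : ι → (Fin n → ℂ) → ℂ}
    (hg : ∀ i, Differentiable ℂ (g i))
    (hVg : ∀ i, (V (b i) : Lp ℂ 2 (weightMeasure Φ h)) =ᵐ[weightMeasure Φ h] g i) (t : Finset ι) :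
    ∑ i ∈ t, ‖g i x‖ ^ 2 ≤ M := by
  set a := ∑ i ∈ t, ‖g i x‖ ^ 2 with ha
  have ha0 : 0 ≤ a := Finset.sum_nonneg fun i _ => by positivity
  -- Test the bound on the combination that represents evaluation at `x` on the span of the family.
  set c : ι → ℂ := fun i => (starRingEnd ℂ) (g i x) with hc
  set w : bergmanSpace Φ h := V (∑ i ∈ t, c i • b i) with hw
  have hnorm : ‖w‖ ^ 2 ≤ a := by
    have h1 : ‖w‖ ≤ ‖∑ i ∈ t, c i • b i‖ :=
      (V.le_of_opNorm_le hV _).trans_eq (one_mul _)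
    have h2 : ‖∑ i ∈ t, c i • b i‖ ^ 2 = a := by
      have h3 := hb.inner_sum c c t
      rw [inner_self_eq_norm_sq_to_K] at h3
      have h4 : ((‖∑ i ∈ t, c i • b i‖ ^ 2 : ℝ) : ℂ) = (a : ℂ) := by
        push_cast [ha]
        refine h3.trans (Finset.sum_congr rfl fun i _ => ?_)
        rw [hc]
        simp only
        rw [Complex.conj_conj, Complex.mul_conj']
      exact_mod_cast h4
    rw [← h2]
    gcongr
  set u : (Fin n → ℂ) → ℂ := fun y => ∑ i ∈ t, c i * g i y with hu
  have hwu : (w : Lp ℂ 2 (weightMeasure Φ h)) =ᵐ[weightMeasure Φ h] u := by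
    have h1 : (w : Lp ℂ 2 (weightMeasure Φ h)) =
        ∑ i ∈ t, c i • (V (b i) : Lp ℂ 2 (weightMeasure Φ h)) := by
      rw [hw, map_sum]
      simp
    rw [h1]
    refine (Lp.coeFn_finsetSum _ _).trans ?_
    have h2 : ∀ᵐ y ∂(weightMeasure Φ h), ∀ i ∈ t,
        (c i • (V (b i) : Lp ℂ 2 (weightMeasure Φ h)) : Lp ℂ 2 (weightMeasure Φ h)) y =
          c i * g i y := by
      rw [Filter.eventually_all_finset]
      intro i _
      filter_upwards [Lp.coeFn_smul (c i) (V (b i) : Lp ℂ 2 (weightMeasure Φ h)), hVg i]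
        with y h3 h4
      rw [h3, Pi.smul_apply, h4, smul_eq_mul]
    filter_upwards [h2] with y hy
    rw [Finset.sum_apply]
    exact Finset.sum_congr rfl hy
  have hud : Differentiable ℂ u := by
    rw [hu]
    fun_prop
  have hux : u x = (a : ℂ) := by
    rw [hu, ha]
    push_cast
    exact Finset.sum_congr rfl fun i _ => by rw [hc]; exact Complex.conj_mul' _
  have h1 := hM w u hud hwu
  rw [hux, Complex.norm_of_nonneg ha0] at h1
  change a ^ 2 ≤ M * ‖w‖ ^ 2 at h1
  rcases ha0.eq_or_lt with h0 | h0
  · rwa [← h0]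
  · exact le_of_mul_le_mul_right (by nlinarith [mul_le_mul_of_nonneg_left hnorm hM0]) h0

theorem coeFn_mulOp {n : ℕ} (Φ : C(Fin n → ℂ, ℝ)) (h : ℝ) (p : (Fin n → ℂ) →ᵇ ℂ)
    (f : Lp ℂ 2 (weightMeasure Φ h)) :
    mulOp Φ h p f =ᵐ[weightMeasure Φ h] fun x => p x * f x := by
  have h0 := memLp_top_of_bound (μ := weightMeasure Φ h) p.continuous.aestronglyMeasurable ‖p‖
    (Eventually.of_forall p.norm_coe_le_norm)
  have h1 := (ContinuousLinearMap.mul ℂ ℂ).coeFn_holder (r := 2) (h0.toLp p) f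
  filter_upwards [h1, h0.coeFn_toLp] with x h2 h3
  rw [← h3]
  exact h2

theorem inner_toeplitz {n : ℕ} (Φ : C(Fin n → ℂ, ℝ)) (h : ℝ) (p : (Fin n → ℂ) →ᵇ ℂ)
    (v u : bergmanSpace Φ h) :
    ⟪v, toeplitz Φ h p u⟫_ℂ = ⟪(v : Lp ℂ 2 (weightMeasure Φ h)), mulOp Φ h p u⟫_ℂ := by
  have h1 : bergmanProj Φ h u = u :=
    (bergmanSpace Φ h).orthogonalProjectionOnto_mem_subspace_eq_self u
  have h2 : toeplitz Φ h p u = bergmanProj Φ h (mulOp Φ h p u) := by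
    simp [toeplitz, h1]
  rw [h2, Submodule.coe_inner]
  exact Submodule.inner_orthogonalProjectionOnto_eq_of_mem_left v _

theorem integrable_mul_exp_weightMeasure {n : ℕ} (Φ : C(Fin n → ℂ, ℝ)) (h : ℝ)
    {q : (Fin n → ℂ) → ℝ} (hq : Integrable q) :
    Integrable (fun x => q x * Real.exp (2 * Φ x / h)) (weightMeasure Φ h) ∧
      ∫ x, q x * Real.exp (2 * Φ x / h) ∂(weightMeasure Φ h) = ∫ x, q x := by
  have hm : Measurable fun x => (Real.exp (-2 * Φ x / h)).toNNReal :=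
    Continuous.measurable (by fun_prop)
  have hμ : weightMeasure Φ h =
      volume.withDensity fun x => ((Real.exp (-2 * Φ x / h)).toNNReal : ℝ≥0∞) := rfl
  have hcancel : (fun x => (Real.exp (-2 * Φ x / h)).toNNReal • (q x * Real.exp (2 * Φ x / h))) =
      q := by
    ext x
    have h6 : Real.exp (-2 * Φ x / h) * Real.exp (2 * Φ x / h) = 1 := by
      rw [← Real.exp_add]; convert Real.exp_zero using 2; ring
    rw [NNReal.smul_def, Real.coe_toNNReal _ (Real.exp_pos _).le, smul_eq_mul, mul_left_comm, h6,
      mul_one]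
  rw [hμ]
  refine ⟨?_, ?_⟩
  · rw [integrable_withDensity_iff_integrable_smul hm, hcancel]
    exact hq
  · rw [integral_withDensity_eq_integral_smul hm, hcancel]

/-- The trace norm of a Toeplitz operator is at most the integral of `|p|` against the Bergman kernel
on the diagonal, here replaced by an upper bound `K e^{2Φ/h}`. -/
theorem traceNorm_toeplitz_le {n : ℕ} {Φ : C(Fin n → ℂ, ℝ)} {h K : ℝ} (hK0 : 0 ≤ K)
    (hK : ∀ (f : Lp ℂ 2 (weightMeasure Φ h)) (u : (Fin n → ℂ) → ℂ),
      Differentiable ℂ u → f =ᵐ[weightMeasure Φ h] u → ∀ x,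
        ‖u x‖ ^ 2 ≤ K * Real.exp (2 * Φ x / h) * ‖f‖ ^ 2)
    (p : (Fin n → ℂ) →ᵇ ℂ) (hp : Integrable p) :
    traceNorm (toeplitz Φ h p) ≤ ENNReal.ofReal (K * ∫ x, ‖p x‖) := by
  refine traceNorm_le_of_forall_contraction _ _ fun s b t V hV => ?_
  choose f hf hbf using fun i => (b i).2
  choose g hg hVg using fun i => (V (b i)).2
  set μ := weightMeasure Φ h with hμ
  have hbound := integrable_mul_exp_weightMeasure Φ h (hp.norm.const_mul K)
  have hinner : ∀ i, ⟪V (b i), toeplitz Φ h p (b i)⟫_ℂ =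
      ∫ x, ⟪(V (b i) : Lp ℂ 2 μ) x, mulOp Φ h p (b i : Lp ℂ 2 μ) x⟫_ℂ ∂μ := fun i => by
    rw [inner_toeplitz, L2.inner_def]
  have hsum : ∑ i ∈ t, ⟪V (b i), toeplitz Φ h p (b i)⟫_ℂ =
      ∫ x, ∑ i ∈ t, ⟪(V (b i) : Lp ℂ 2 μ) x, mulOp Φ h p (b i : Lp ℂ 2 μ) x⟫_ℂ ∂μ := by
    rw [integral_finsetSum _ fun i _ => L2.integrable_inner _ _]
    exact Finset.sum_congr rfl fun i _ => hinner i
  rw [← Complex.re_sum]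
  refine (Complex.re_le_norm _).trans ?_
  rw [hsum, ← integral_const_mul, ← hbound.2]
  refine norm_integral_le_of_norm_le hbound.1 ?_
  have hae : ∀ᵐ x ∂μ, ∀ i ∈ t, (V (b i) : Lp ℂ 2 μ) x = g i x ∧
      mulOp Φ h p (b i : Lp ℂ 2 μ) x = p x * f i x := by
    rw [Filter.eventually_all_finset]
    intro i _
    filter_upwards [hVg i, hbf i, coeFn_mulOp Φ h p (b i)] with x h1 h2 h3
    exact ⟨h1, by rw [h3, h2]⟩
  filter_upwards [hae] with x hx
  have hf2 := sum_norm_sq_le_of_orthonormal (by positivity) (fun f u hu hfu => hK f u hu hfu x)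
    b.orthonormal (V := ContinuousLinearMap.id ℂ _) ContinuousLinearMap.norm_id_le
    hf hbf t
  have hg2 := sum_norm_sq_le_of_orthonormal (by positivity) (fun f u hu hfu => hK f u hu hfu x)
    b.orthonormal hV hg hVg t
  refine (norm_sum_le _ _).trans ?_
  calc ∑ i ∈ t, ‖⟪(V (b i) : Lp ℂ 2 μ) x, mulOp Φ h p (b i : Lp ℂ 2 μ) x⟫_ℂ‖
      ≤ ∑ i ∈ t, ‖p x‖ * ((‖g i x‖ ^ 2 + ‖f i x‖ ^ 2) / 2) := by
        refine Finset.sum_le_sum fun i hi => ?_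
        rw [(hx i hi).1, (hx i hi).2]
        refine (norm_inner_le_norm _ _).trans ?_
        rw [norm_mul, mul_left_comm]
        refine mul_le_mul_of_nonneg_left ?_ (norm_nonneg _)
        nlinarith [sq_nonneg (‖g i x‖ - ‖f i x‖)]
    _ = ‖p x‖ * ((∑ i ∈ t, ‖g i x‖ ^ 2 + ∑ i ∈ t, ‖f i x‖ ^ 2) / 2) := by
        rw [← Finset.mul_sum, ← Finset.sum_div, Finset.sum_add_distrib]
    _ ≤ ‖p x‖ * (K * Real.exp (2 * Φ x / h)) :=
        mul_le_mul_of_nonneg_left (by linarith) (norm_nonneg _)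
    _ = _ := by ring

theorem propositionA1 (n : ℕ) (Φ₀ : QuadraticForm ℝ (Fin n → ℂ)) (hΦ₀ : IsStrictlyPSH Φ₀) :
    ∃ δ : ℝ, 0 < δ ∧ ∀ Φ : C(Fin n → ℂ, ℝ), IsAdmissibleWeight Φ₀ δ Φ →
      (∀ h : ℝ, 0 < h → ∀ p : 𝓢(Fin n → ℂ, ℂ), HasCompactSupport p →
        IsTraceClass (toeplitz Φ h p.toBoundedContinuousFunction)) ∧
      ∃ C : ℝ, 0 < C ∧ ∃ h₀ : ℝ, 0 < h₀ ∧
        ∀ N : ℕ, ∃ q : Seminorm ℂ 𝓢(Fin n → ℂ, ℂ), Continuous q ∧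
          ∀ p : 𝓢(Fin n → ℂ, ℂ), HasCompactSupport p → ∀ h : ℝ, 0 < h → h ≤ h₀ →
            traceNorm (toeplitz Φ h p.toBoundedContinuousFunction) ≤
              ENNReal.ofReal (C / h ^ n * (∫ x, ‖p x‖) + q p * h ^ N) := by
  refine ⟨1, one_pos, fun Φ hΦ => ?_⟩
  obtain ⟨C, hC, hpt⟩ := exists_forall_norm_sq_le Φ
    (contDiff_infty.1 hΦ.contDiff 2) (hΦ.bounded_deriv 2 le_rfl)
  have hmain : ∀ h : ℝ, 0 < h → ∀ p : 𝓢(Fin n → ℂ, ℂ),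
      traceNorm (toeplitz Φ h p.toBoundedContinuousFunction) ≤
        ENNReal.ofReal (C / h ^ n * ∫ x, ‖p x‖) := fun h hh p =>
    traceNorm_toeplitz_le (by positivity) (hpt h hh) p.toBoundedContinuousFunction p.integrable
  refine ⟨fun h hh p _ => (hmain h hh p).trans_lt ENNReal.ofReal_lt_top, C, hC, 1, one_pos,
    fun N => ⟨0, continuous_const, fun p _ h hh _ => ?_⟩⟩
  -- The principal term is already an upper bound, so the seminorms may be taken to be zero.
  simpa using hmain h hh p
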